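/- Let $A=\ell^1(\mathbb Z_+)$ and $C=\ell^1(\mathbb Z)$ be the convolution Banach algebras (complex scalars, $\mathbb Z_+=\{0,1,2,\dots\}$). Let $N$ be a Banach $C$-bimodule (the actions are bounded, but need not be contractive), regarded as a Banach $A$-bimodule via the inclusion homomorphism $A\hookrightarrow C$ (extension by zero). Then: (i) $N$ is $A$-biflat: for every short exact sequence $0\to X\to Y\to Z\to 0$ of Banach $A$-bimodules and bounded bimodule maps which splits as a sequence of Banach spaces, the sequence $$0\to X\mathbin{\widehat\otimes}_{A^e}N\to Y\mathbin{\widehat\otimes}_{A^e}N\to Z\mathbin{\widehat\otimes}_{A^e}N\to 0$$ is exact, where $X\mathbin{\widehat\otimes}_{A^e}N$ is the quotient of the projective tensor product $X\mathbin{\widehat\otimes}N$ by the closed linear span of all $x a\otimes m-x\otimes a m$ and $a x\otimes m-x\otimes m a$ ($a\in A$, $x\in X$, $m\in N$); (ii) $H^n(A,N')=0$ for all $n\ge 1$, where $N'$ is the dual bimodule of $N$, with $\langle a\psi,m\rangle=\langle\psi,ma\rangle$ and $\langle\psi a,m\rangle=\langle\psi,am\rangle$, and $H^n$ is continuous Hochschild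 cohomology, i.e. the cohomology of the complex of bounded $n$-linear maps $A\times\cdots\times A\to N'$ with the Hochschild coboundary operator. -/

import Mathlib

open scoped TensorProduct

universe u v w

noncomputable section

/-! ### The convolution algebra `ℓ¹(S)` of a commutative monoid -/

/-- `ℓ¹(S)`: absolutely summable complex functions on `S` with the norm `‖f‖ = ∑ s, |f s|`. -/
abbrev Ell1 (S : Type*) : Type _ := lp (fun _ : S => ℂ) 1

namespace Ell1

variable {S : Type*}

/-- `(f * g)(s) = ∑_{a + b = s} f(a) g(b)`. -/
def conv [Add S] (f g : S → ℂ) (s : S) : ℂ :=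
  ∑' p : {p : S × S // p.1 + p.2 = s}, f p.1.1 * g p.1.2

theorem summable_norm (f : Ell1 S) : Summable fun s => ‖f s‖ := by
  simpa using (lp.memℓp f).summable (by simp)

theorem norm_eq (f : Ell1 S) : ‖f‖ = ∑' s, ‖f s‖ := by
  rw [lp.norm_eq_tsum_rpow (by simp)]
  simp

theorem summable_prod_norm (f g : Ell1 S) :
    Summable fun p : S × S => ‖f p.1 * g p.2‖ := by
  simpa [norm_mul] using (summable_norm f).mul_of_nonneg (summable_norm g)
    (fun _ => norm_nonneg _) (fun _ => norm_nonneg _)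

theorem hasSum_fiber [Add S] {E : Type*} [NormedAddCommGroup E] [CompleteSpace E]
    {F : S × S → E} (hF : Summable fun p => ‖F p‖) :
    HasSum (fun s => ∑' p : {p : S × S // p.1 + p.2 = s}, F p.1) (∑' p, F p) := by
  have h1 : Summable F := hF.of_norm
  have h2 : HasSum (fun x : Σ s, {p : S × S // p.1 + p.2 = s} => F x.2.1) (∑' p, F p) :=
    (Equiv.sigmaFiberEquiv (fun p : S × S => p.1 + p.2)).hasSum_iff.2 h1.hasSum
  exact h2.sigma (fun s => (h1.subtype _).hasSum)

theorem summable_norm_conv [Add S] (f g : Ell1 S) : Summable fun s => ‖conv f g s‖ := by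
  have h := summable_prod_norm f g
  refine Summable.of_nonneg_of_le (fun _ => norm_nonneg _) (fun s => ?_)
    (hasSum_fiber (F := fun p : S × S => ‖f p.1 * g p.2‖) (by simpa using h)).summable
  exact norm_tsum_le_tsum_norm (h.subtype _)

theorem tsum_norm_conv_le [Add S] (f g : Ell1 S) : ∑' s, ‖conv f g s‖ ≤ ‖f‖ * ‖g‖ := by
  have h := summable_prod_norm f g
  have h1 := hasSum_fiber (F := fun p : S × S => ‖f p.1 * g p.2‖) (by simpa using h)
  calc ∑' s, ‖conv f g s‖
      ≤ ∑' s, ∑' p : {p : S × S // p.1 + p.2 = s}, ‖f p.1.1 * g p.1.2‖ :=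
        (summable_norm_conv f g).tsum_le_tsum
          (fun s => norm_tsum_le_tsum_norm (h.subtype _)) h1.summable
    _ = ∑' p : S × S, ‖f p.1 * g p.2‖ := h1.tsum_eq
    _ = ‖f‖ * ‖g‖ := by
        rw [norm_eq, norm_eq, tsum_mul_tsum_of_summable_norm (by simpa using summable_norm f)
          (by simpa using summable_norm g)]
        simp

instance instMul [Add S] : Mul (Ell1 S) where
  mul f g := ⟨conv f g, memℓp_gen (by simpa using summable_norm_conv f g)⟩

theorem mul_apply [Add S] (f g : Ell1 S) (s : S) :
    (f * g) s = ∑' p : {p : S × S // p.1 + p.2 = s}, f p.1.1 * g p.1.2 := rfl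

theorem summable_fiber [Add S] (f g : Ell1 S) (s : S) :
    Summable fun p : {p : S × S // p.1 + p.2 = s} => f p.1.1 * g p.1.2 :=
  (summable_prod_norm f g).of_norm.subtype _

/-- The unit mass at `0`. -/
instance instOne [AddMonoid S] : One (Ell1 S) where
  one := open Classical in lp.single 1 0 1

open Classical in
theorem one_apply [AddMonoid S] (s : S) : (1 : Ell1 S) s = if s = 0 then 1 else 0 := by
  change lp.single (E := fun _ : S => ℂ) 1 (0 : S) (1 : ℂ) s = _
  rw [lp.single_apply, Pi.single_apply]

variable [AddCommMonoid S]

theorem mul_comm_aux (f g : Ell1 S) : f * g = g * f := by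
  ext s
  rw [mul_apply, mul_apply]
  let e : {p : S × S // p.1 + p.2 = s} ≃ {p : S × S // p.1 + p.2 = s} :=
    (Equiv.prodComm S S).subtypeEquiv (fun p => by simp [add_comm])
  rw [← e.tsum_eq]
  exact tsum_congr fun p => mul_comm _ _

theorem one_mul_aux (f : Ell1 S) : 1 * f = f := by
  ext s
  rw [mul_apply, tsum_eq_single (⟨(0, s), by simp⟩ : {p : S × S // p.1 + p.2 = s})]
  · simp [one_apply]
  · rintro ⟨⟨a, b⟩, h⟩ hne
    have : a ≠ 0 := by
      rintro rfl
      apply hne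
      simp only [zero_add] at h
      simp [h]
    simp [one_apply, this]

/-- Pairing a convolution against a bounded function. -/
theorem tsum_mul_apply (f g : Ell1 S) (φ : S → ℂ) (hφ : ∀ s, ‖φ s‖ ≤ 1) :
    ∑' s, φ s * (f * g) s = ∑' p : S × S, φ (p.1 + p.2) * (f p.1 * g p.2) := by
  have h : Summable fun p : S × S => ‖φ (p.1 + p.2) * (f p.1 * g p.2)‖ := by
    refine Summable.of_nonneg_of_le (fun _ => norm_nonneg _) (fun p => ?_) (summable_prod_norm f g)
    rw [norm_mul]
    exact mul_le_of_le_one_left (norm_nonneg _) (hφ _)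
  rw [← (hasSum_fiber h).tsum_eq]
  refine tsum_congr fun s => ?_
  rw [mul_apply, ← tsum_mul_left]
  refine tsum_congr fun p => ?_
  rw [p.2]

open Classical in
theorem mul_apply_eq (f g : Ell1 S) (s : S) :
    (f * g) s = ∑' p : S × S, (if p.1 + p.2 = s then (1 : ℂ) else 0) * (f p.1 * g p.2) := by
  rw [← tsum_mul_apply f g (fun t => if t = s then (1 : ℂ) else 0)
    (fun t => by split_ifs <;> simp), tsum_eq_single s]
  · simp
  · intro t ht
    simp [ht]

open Classical in
theorem mul_mul_apply (f g h : Ell1 S) (s : S) :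
    ((f * g) * h) s = ∑' x : S × S × S,
      (if x.2.1 + x.2.2 + x.1 = s then (1 : ℂ) else 0) * (f x.2.1 * g x.2.2 * h x.1) := by
  have key : Summable fun p : S × S × S => ‖h p.1 * (f p.2.1 * g p.2.2)‖ := by
    simpa [norm_mul] using (summable_norm h).mul_of_nonneg (summable_prod_norm f g)
      (fun _ => norm_nonneg _) (fun _ => norm_nonneg _)
  have key2 : Summable fun x : S × S × S =>
      (if x.2.1 + x.2.2 + x.1 = s then (1 : ℂ) else 0) * (f x.2.1 * g x.2.2 * h x.1) := by
    refine Summable.of_norm_bounded key (fun x => ?_)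
    split_ifs
    · simp [mul_comm]
    · simp
      positivity
  have key3 : Summable fun p : S × S =>
      (if p.1 + p.2 = s then (1 : ℂ) else 0) * (h p.1 * (f * g) p.2) := by
    refine Summable.of_norm_bounded (summable_prod_norm h (f * g)) (fun x => ?_)
    split_ifs <;> simp
    positivity
  rw [mul_comm_aux, mul_apply_eq, key3.tsum_prod, key2.tsum_prod]
  refine tsum_congr fun c => ?_
  have := tsum_mul_apply f g (fun t => if c + t = s then (1 : ℂ) else 0)
    (fun t => by split_ifs <;> simp)
  have h2 := congrArg (h c * ·) this
  simp only [← tsum_mul_left] at h2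
  convert h2 using 1
  · exact tsum_congr fun t => by ring
  · refine tsum_congr fun p => ?_
    rw [add_comm (p.1 + p.2) c]
    ring

theorem mul_assoc_aux (f g h : Ell1 S) : f * g * h = f * (g * h) := by
  classical
  ext s
  rw [mul_mul_apply, mul_comm_aux f (g * h), mul_mul_apply]
  let e : S × S × S ≃ S × S × S :=
    { toFun := fun x => (x.2.2, x.1, x.2.1)
      invFun := fun x => (x.2.1, x.2.2, x.1)
      left_inv := fun _ => rfl
      right_inv := fun _ => rfl }
  rw [← e.tsum_eq]
  refine tsum_congr fun x => ?_
  simp only [e, Equiv.coe_fn_mk]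
  have hx : (x.1 + x.2.1 + x.2.2 = s) = (x.2.1 + x.2.2 + x.1 = s) := by
    rw [show x.1 + x.2.1 + x.2.2 = x.2.1 + x.2.2 + x.1 by abel]
  simp only [hx]
  ring

theorem mul_add_aux (f g h : Ell1 S) : f * (g + h) = f * g + f * h := by
  ext s
  rw [lp.coeFn_add, Pi.add_apply, mul_apply, mul_apply, mul_apply,
    ← (summable_fiber f g s).tsum_add (summable_fiber f h s)]
  exact tsum_congr fun p => by simp [mul_add]

theorem zero_mul_aux (f : Ell1 S) : 0 * f = 0 := by
  ext s
  simp [mul_apply]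

/-- `ℓ¹(S)` is a commutative Banach algebra under convolution. -/
instance instNormedCommRing : NormedCommRing (Ell1 S) :=
  { (inferInstance : NormedAddCommGroup (Ell1 S)), instMul, instOne with
    mul_comm := mul_comm_aux
    mul_assoc := mul_assoc_aux
    one_mul := one_mul_aux
    mul_one := fun f => (mul_comm_aux f 1).trans (one_mul_aux f)
    left_distrib := mul_add_aux
    right_distrib := fun f g h => by
      rw [mul_comm_aux, mul_add_aux, mul_comm_aux h f, mul_comm_aux h g]
    zero_mul := zero_mul_aux
    mul_zero := fun f => (mul_comm_aux f 0).trans (zero_mul_aux f)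
    norm_mul_le := fun f g => (norm_eq (f * g)).le.trans (tsum_norm_conv_le f g) }

theorem smul_mul_aux (c : ℂ) (f g : Ell1 S) : (c • f) * g = c • (f * g) := by
  ext s
  rw [lp.coeFn_smul, Pi.smul_apply, mul_apply, mul_apply, smul_eq_mul, ← tsum_mul_left]
  exact tsum_congr fun p => by simp [mul_assoc]

instance instAlgebra : Algebra ℂ (Ell1 S) :=
  Algebra.ofModule smul_mul_aux
    (fun c f g => by rw [mul_comm, smul_mul_aux, mul_comm])

instance instNormedAlgebra : NormedAlgebra ℂ (Ell1 S) where
  norm_smul_le := norm_smul_le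

/-! ### The inclusion of `ℓ¹(ℤ₊)` in `ℓ¹(ℤ)` -/

/-- Extension by zero of a function on `ℤ₊ = ℕ` to `ℤ`. -/
def extendZero (f : ℕ → ℂ) (k : ℤ) : ℂ := if 0 ≤ k then f k.toNat else 0

@[simp] theorem extendZero_natCast (f : ℕ → ℂ) (n : ℕ) : extendZero f n = f n := by
  simp [extendZero]

theorem extendZero_of_neg (f : ℕ → ℂ) {k : ℤ} (hk : k < 0) : extendZero f k = 0 := by
  simp [extendZero, hk]

theorem support_extendZero_subset (f : ℕ → ℂ) (F : ℤ → ℂ → ℝ) (hF : ∀ k, F k 0 = 0) :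
    (Function.support fun k : ℤ => F k (extendZero f k)) ⊆ Set.range ((↑) : ℕ → ℤ) := by
  intro k hk
  by_contra h
  have : k < 0 := by
    by_contra h0
    exact h ⟨k.toNat, by omega⟩
  exact hk (by simp [extendZero_of_neg f this, hF])

theorem hasSum_norm_extendZero (f : Ell1 ℕ) :
    HasSum (fun k : ℤ => ‖extendZero f k‖) ‖f‖ := by
  refine (Function.Injective.hasSum_iff (g := ((↑) : ℕ → ℤ)) Nat.cast_injective ?_).1 ?_
  · intro k hk
    by_contra h
    exact hk (support_extendZero_subset f (fun _ z => ‖z‖) (by simp) h)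
  · have := (summable_norm f).hasSum
    rw [← norm_eq] at this
    simpa [Function.comp_def] using this

/-- The underlying function of the inclusion. -/
def inclFun (f : Ell1 ℕ) : Ell1 ℤ :=
  ⟨extendZero f, memℓp_gen (by simpa using (hasSum_norm_extendZero f).summable)⟩

theorem inclFun_apply (f : Ell1 ℕ) (k : ℤ) : inclFun f k = extendZero f k := rfl

theorem norm_inclFun (f : Ell1 ℕ) : ‖inclFun f‖ = ‖f‖ := by
  rw [norm_eq]
  exact (hasSum_norm_extendZero f).tsum_eq

theorem inclFun_mul (f g : Ell1 ℕ) : inclFun (f * g) = inclFun f * inclFun g := by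
  ext k
  rw [inclFun_apply, mul_apply]
  rcases lt_or_ge k 0 with hk | hk
  · rw [extendZero_of_neg _ hk]
    symm
    convert tsum_zero with p
    revert p
    rintro ⟨⟨a, b⟩, h⟩
    have h' : a < 0 ∨ b < 0 := by simp only at h; omega
    rcases h' with h' | h' <;> simp [inclFun_apply, extendZero_of_neg _ h']
  · obtain ⟨n, rfl⟩ := Int.eq_ofNat_of_zero_le hk
    rw [extendZero_natCast, mul_apply]
    let i : {p : ℕ × ℕ // p.1 + p.2 = n} → {p : ℤ × ℤ // p.1 + p.2 = (n : ℤ)} :=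
      fun p => ⟨((p.1.1 : ℤ), (p.1.2 : ℤ)), by have := p.2; simp only; omega⟩
    have hi : Function.Injective i := by
      rintro ⟨⟨a, b⟩, h⟩ ⟨⟨c, d⟩, h'⟩ heq
      simpa [i] using heq
    rw [← hi.tsum_eq]
    · exact tsum_congr fun p => by simp [i, inclFun_apply]
    · rintro ⟨⟨a, b⟩, h⟩ hne
      have ha : 0 ≤ a := by
        by_contra h0
        exact hne (by simp [inclFun_apply, extendZero_of_neg _ (not_le.1 h0)])
      have hb : 0 ≤ b := by
        by_contra h0
        exact hne (by simp [inclFun_apply, extendZero_of_neg _ (not_le.1 h0)])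
      refine ⟨⟨(a.toNat, b.toNat), by simp only at h ⊢; omega⟩, ?_⟩
      simp [i, ha, hb]

/-- The inclusion `ℓ¹(ℤ₊) ↪ ℓ¹(ℤ)`: extension by zero, a unital homomorphism. -/
def incl : Ell1 ℕ →A[ℂ] Ell1 ℤ where
  toAlgHom := AlgHom.ofLinearMap
    { toFun := inclFun
      map_add' := fun f g => by
        ext k
        rw [lp.coeFn_add, Pi.add_apply]
        simp only [inclFun_apply, extendZero]
        split_ifs <;> simp
      map_smul' := fun c f => by
        ext k
        rw [RingHom.id_apply, lp.coeFn_smul, Pi.smul_apply]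
        simp only [inclFun_apply, extendZero]
        split_ifs <;> simp }
    (by
      ext k
      change extendZero (1 : Ell1 ℕ) k = _
      rw [one_apply]
      simp only [extendZero, one_apply]
      split_ifs <;> first | rfl | omega)
    inclFun_mul
  cont := by
    refine AddMonoidHomClass.continuous_of_bound (AlgHom.ofLinearMap _ _ _) 1 (fun f => ?_)
    rw [one_mul]
    exact (norm_inclFun f).le

theorem incl_apply (f : Ell1 ℕ) (k : ℤ) : incl f k = if 0 ≤ k then f k.toNat else 0 := rfl

end Ell1

/-! ### Banach bimodules -/

section Bimodules

variable (A : Type*) [NormedRing A] [NormedAlgebra ℂ A]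

/-- A Banach `A`-bimodule structure on the Banach space `M`: continuous left and right actions
`lact a m = a · m` and `ract a m = m · a` that are associative and commute. The actions need not
be contractive, and the unit of `A` need not act as the identity. -/
structure BanachBimodule (M : Type*) [NormedAddCommGroup M] [NormedSpace ℂ M] where
  lact : A →L[ℂ] M →L[ℂ] M
  ract : A →L[ℂ] M →L[ℂ] M
  lact_mul : ∀ a b m, lact (a * b) m = lact a (lact b m)
  ract_mul : ∀ a b m, ract (a * b) m = ract b (ract a m)
  lact_ract : ∀ a b m, lact a (ract b m) = ract b (lact a m)

variable {A}
variable {M : Type*} [NormedAddCommGroup M] [NormedSpace ℂ M]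

namespace BanachBimodule

/-- Restriction of the actions along a continuous homomorphism. -/
def restrict {C : Type*} [NormedRing C] [NormedAlgebra ℂ C] (φ : A →A[ℂ] C)
    (B : BanachBimodule C M) : BanachBimodule A M where
  lact := B.lact.comp φ.toContinuousLinearMap
  ract := B.ract.comp φ.toContinuousLinearMap
  lact_mul a b m := by simp [B.lact_mul]
  ract_mul a b m := by simp [B.ract_mul]
  lact_ract a b m := by simp [B.lact_ract]

/-- The dual bimodule `M'`, with `⟨a · ψ, m⟩ = ⟨ψ, m · a⟩` and `⟨ψ · a, m⟩ = ⟨ψ, a · m⟩`. -/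
def dual (B : BanachBimodule A M) : BanachBimodule A (StrongDual ℂ M) where
  lact := (ContinuousLinearMap.compL ℂ M M ℂ).flip.comp B.ract
  ract := (ContinuousLinearMap.compL ℂ M M ℂ).flip.comp B.lact
  lact_mul a b ψ := by ext m; simp [B.ract_mul]
  ract_mul a b ψ := by ext m; simp [B.lact_mul]
  lact_ract a b ψ := by ext m; simp [B.lact_ract]

theorem dual_lact_apply (B : BanachBimodule A M) (a : A) (ψ : StrongDual ℂ M) (m : M) :
    B.dual.lact a ψ m = ψ (B.ract a m) := rfl

theorem dual_ract_apply (B : BanachBimodule A M) (a : A) (ψ : StrongDual ℂ M) (m : M) :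
    B.dual.ract a ψ m = ψ (B.lact a m) := rfl

/-- `f` is an `A`-bimodule map. -/
def IsMap {X Y : Type*} [NormedAddCommGroup X] [NormedSpace ℂ X] [NormedAddCommGroup Y]
    [NormedSpace ℂ Y] (BX : BanachBimodule A X) (BY : BanachBimodule A Y) (f : X →L[ℂ] Y) :
    Prop :=
  (∀ a x, f (BX.lact a x) = BY.lact a (f x)) ∧ ∀ a x, f (BX.ract a x) = BY.ract a (f x)

end BanachBimodule

end Bimodules

/-! ### Continuous Hochschild cohomology -/

namespace Hochschild

variable {A : Type*} [NormedRing A] [NormedAlgebra ℂ A]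
variable {M : Type*} [NormedAddCommGroup M] [NormedSpace ℂ M]

variable (A M) in
/-- `n`-cochains: bounded `n`-linear maps `A × ⋯ × A → M`. -/
abbrev Cochain (n : ℕ) : Type _ := ContinuousMultilinearMap ℂ (fun _ : Fin n => A) M

/-- `(a₁, …, aₙ₊₁) ↦ a₁ · ψ(a₂, …, aₙ₊₁)`. -/
def firstFace (B : BanachBimodule A M) {n : ℕ} (ψ : Cochain A M n) : Cochain A M (n + 1) :=
  ContinuousLinearMap.uncurryLeft (Ei := fun _ : Fin (n + 1) => A)
    (((ContinuousLinearMap.compContinuousMultilinearMapL ℂ (fun _ : Fin n => A) M M).flip ψ).comp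
      B.lact)

theorem firstFace_apply (B : BanachBimodule A M) {n : ℕ} (ψ : Cochain A M n)
    (a : Fin (n + 1) → A) : firstFace B ψ a = B.lact (a 0) (ψ (Fin.tail a)) := rfl

/-- `(a₁, …, aₙ₊₁) ↦ ψ(a₁, …, aₙ) · aₙ₊₁`. -/
def lastFace (B : BanachBimodule A M) {n : ℕ} (ψ : Cochain A M n) : Cochain A M (n + 1) :=
  ContinuousMultilinearMap.uncurryRight (Ei := fun _ : Fin (n + 1) => A)
    (B.ract.flip.compContinuousMultilinearMap ψ)

theorem lastFace_apply (B : BanachBimodule A M) {n : ℕ} (ψ : Cochain A M n)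
    (a : Fin (n + 1) → A) :
    lastFace B ψ a = B.ract (a (Fin.last n)) (ψ (Fin.init a)) := rfl

theorem contractNth_update {n : ℕ} (j : Fin n) (a : Fin (n + 1) → A) (i : Fin (n + 1)) :
    ∃ (k : Fin n) (L : A →ₗ[ℂ] A), ∀ x : A,
      j.castSucc.contractNth (· * ·) (Function.update a i x) =
        Function.update (j.castSucc.contractNth (· * ·) a) k (L x) := by
  obtain ⟨j, hj⟩ := j
  obtain ⟨i, hi⟩ := i
  have main : ∀ (k : Fin n) (L : A →ₗ[ℂ] A), (∀ (x : A) (l : Fin n),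
      Fin.contractNth (Fin.castSucc ⟨j, hj⟩) (· * ·) (Function.update a ⟨i, hi⟩ x) l =
        if (l : ℕ) = k then L x
        else Fin.contractNth (Fin.castSucc ⟨j, hj⟩) (· * ·) a l) →
      ∃ (k : Fin n) (L : A →ₗ[ℂ] A), ∀ x : A,
      Fin.contractNth (Fin.castSucc ⟨j, hj⟩) (· * ·) (Function.update a ⟨i, hi⟩ x) =
        Function.update (Fin.contractNth (Fin.castSucc ⟨j, hj⟩) (· * ·) a) k (L x) := by
    intro k L h
    refine ⟨k, L, fun x => funext fun l => ?_⟩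
    rw [h, Function.update_apply]
    simp only [Fin.ext_iff]
  rcases lt_trichotomy i j with h | h | h
  · refine main ⟨i, by omega⟩ LinearMap.id fun x l => ?_
    simp only [Fin.contractNth, Function.update_apply, Fin.ext_iff, Fin.val_castSucc, Fin.val_succ,
      LinearMap.id_apply]
    split_ifs <;> first | rfl | omega
  · refine main ⟨j, hj⟩ (LinearMap.mulRight ℂ (a ⟨j + 1, by omega⟩)) fun x l => ?_
    obtain ⟨l, hl⟩ := l
    simp only [Fin.contractNth, Function.update_apply, Fin.ext_iff, Fin.val_castSucc, Fin.val_succ,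
      LinearMap.mulRight_apply]
    split_ifs <;> first | rfl | omega | (subst_vars; rfl)
  · by_cases h' : i = j + 1
    · refine main ⟨j, hj⟩ (LinearMap.mulLeft ℂ (a ⟨j, by omega⟩)) fun x l => ?_
      obtain ⟨l, hl⟩ := l
      simp only [Fin.contractNth, Function.update_apply, Fin.ext_iff, Fin.val_castSucc,
        Fin.val_succ, LinearMap.mulLeft_apply]
      split_ifs <;> first | rfl | omega | (subst_vars; rfl)
    · refine main ⟨i - 1, by omega⟩ LinearMap.id fun x l => ?_
      simp only [Fin.contractNth, Function.update_apply, Fin.ext_iff, Fin.val_castSucc,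
        Fin.val_succ, LinearMap.id_apply]
      split_ifs <;> first | rfl | omega

/-- `(a₁, …, aₙ₊₁) ↦ ψ(a₁, …, aⱼ aⱼ₊₁, …, aₙ₊₁)`; the index `j` here starts from `0`. -/
def midFace {n : ℕ} (j : Fin n) (ψ : Cochain A M n) : Cochain A M (n + 1) where
  toFun a := ψ (j.castSucc.contractNth (· * ·) a)
  map_update_add' := by
    intro inst a i x y
    obtain rfl := Subsingleton.elim inst (instDecidableEqFin _)
    obtain ⟨k, L, h⟩ := contractNth_update j a i
    simp only [h, map_add, ψ.map_update_add]
  map_update_smul' := by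
    intro inst a i c x
    obtain rfl := Subsingleton.elim inst (instDecidableEqFin _)
    obtain ⟨k, L, h⟩ := contractNth_update j a i
    simp only [h, map_smul, ψ.map_update_smul]
  cont := by
    refine ψ.cont.comp (continuous_pi fun k => ?_)
    unfold Fin.contractNth
    split_ifs <;> fun_prop

theorem midFace_apply {n : ℕ} (j : Fin n) (ψ : Cochain A M n) (a : Fin (n + 1) → A) :
    midFace j ψ a = ψ (j.castSucc.contractNth (· * ·) a) := rfl

/-- The Hochschild coboundary operator
`(dψ)(a₁, …, aₙ₊₁) = a₁ · ψ(a₂, …, aₙ₊₁) + ∑ⱼ (-1)ʲ ψ(a₁, …, aⱼ aⱼ₊₁, …, aₙ₊₁)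
  + (-1)ⁿ⁺¹ ψ(a₁, …, aₙ) · aₙ₊₁`. -/
def coboundary (B : BanachBimodule A M) (n : ℕ) : Cochain A M n →ₗ[ℂ] Cochain A M (n + 1) where
  toFun ψ := firstFace B ψ + ∑ j : Fin n, (-1 : ℂ) ^ ((j : ℕ) + 1) • midFace j ψ
    + (-1 : ℂ) ^ (n + 1) • lastFace B ψ
  map_add' ψ χ := by
    ext a
    simp only [add_apply, sum_apply, smul_apply, firstFace_apply, lastFace_apply, midFace_apply,
      map_add, smul_add, Finset.sum_add_distrib]
    abel
  map_smul' c ψ := by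
    ext a
    simp only [add_apply, sum_apply, smul_apply, firstFace_apply, lastFace_apply, midFace_apply,
      map_smul, smul_add, Finset.smul_sum, RingHom.id_apply, smul_comm c]

theorem coboundary_apply (B : BanachBimodule A M) (n : ℕ) (ψ : Cochain A M n)
    (a : Fin (n + 1) → A) :
    coboundary B n ψ a = B.lact (a 0) (ψ (Fin.tail a))
      + ∑ j : Fin n, (-1 : ℂ) ^ ((j : ℕ) + 1) • ψ (j.castSucc.contractNth (· * ·) a)
      + (-1 : ℂ) ^ (n + 1) • B.ract (a (Fin.last n)) (ψ (Fin.init a)) := by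
  simp [coboundary, firstFace_apply, lastFace_apply, midFace_apply]

/-- `Zⁿ(A, M)`. -/
def cocycles (B : BanachBimodule A M) (n : ℕ) : Submodule ℂ (Cochain A M n) :=
  LinearMap.ker (coboundary B n)

/-- `Bⁿ(A, M)`. -/
def coboundaries (B : BanachBimodule A M) : (n : ℕ) → Submodule ℂ (Cochain A M n)
  | 0 => ⊥
  | n + 1 => LinearMap.range (coboundary B n)

/-- The continuous Hochschild cohomology group `Hⁿ(A, M) = Zⁿ(A, M) / Bⁿ(A, M)`. -/
abbrev Cohomology (B : BanachBimodule A M) (n : ℕ) : Type _ :=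
  cocycles B n ⧸ (coboundaries B n).submoduleOf (cocycles B n)

end Hochschild

/-! ### Projective tensor products -/

/-- The algebraic tensor product `X ⊗ M`, to be normed by the projective norm. -/
def AlgTensor (X M : Type*) [NormedAddCommGroup X] [NormedSpace ℂ X] [NormedAddCommGroup M]
    [NormedSpace ℂ M] : Type _ := X ⊗[ℂ] M

section ProjectiveTensor

variable {X : Type*} [NormedAddCommGroup X] [NormedSpace ℂ X]
variable {Y : Type*} [NormedAddCommGroup Y] [NormedSpace ℂ Y]
variable {M : Type*} [NormedAddCommGroup M] [NormedSpace ℂ M]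

namespace AlgTensor

instance : AddCommGroup (AlgTensor X M) := inferInstanceAs (AddCommGroup (X ⊗[ℂ] M))
instance : Module ℂ (AlgTensor X M) := inferInstanceAs (Module ℂ (X ⊗[ℂ] M))

/-- The elementary tensor `x ⊗ m`. -/
def mk (x : X) (m : M) : AlgTensor X M := x ⊗ₜ[ℂ] m

/-- The tensor `∑ xᵢ ⊗ mᵢ` of a finite list of pairs `(xᵢ, mᵢ)`. -/
def ofList (l : List (X × M)) : AlgTensor X M := (l.map fun p => mk p.1 p.2).sum

/-- `∑ ‖xᵢ‖ ‖mᵢ‖`. -/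
def cost (l : List (X × M)) : ℝ := (l.map fun p => ‖p.1‖ * ‖p.2‖).sum

theorem cost_nonneg (l : List (X × M)) : 0 ≤ cost l :=
  List.sum_nonneg fun r hr => by
    obtain ⟨p, -, rfl⟩ := List.mem_map.1 hr
    positivity

theorem exists_ofList (u : AlgTensor X M) : ∃ l, ofList l = u := by
  refine TensorProduct.induction_on (motive := fun u : X ⊗[ℂ] M => ∃ l, ofList l = u) u
    ⟨[], rfl⟩ (fun x m => ⟨[(x, m)], add_zero (mk x m)⟩) ?_
  rintro _ _ ⟨l, rfl⟩ ⟨l', rfl⟩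
  exact ⟨l ++ l', by simp [ofList]; rfl⟩

/-- The projective norm: the infimum of `∑ ‖xᵢ‖ ‖mᵢ‖` over all representations
`u = ∑ xᵢ ⊗ mᵢ`. -/
def projNorm (u : AlgTensor X M) : ℝ := ⨅ l : {l : List (X × M) // ofList l = u}, cost l.1

theorem bddBelow_cost (u : AlgTensor X M) :
    BddBelow (Set.range fun l : {l : List (X × M) // ofList l = u} => cost l.1) :=
  ⟨0, by rintro _ ⟨l, rfl⟩; exact cost_nonneg l.1⟩

theorem projNorm_le (l : List (X × M)) : projNorm (ofList l) ≤ cost l :=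
  ciInf_le (bddBelow_cost (ofList l)) ⟨l, rfl⟩

theorem le_projNorm {u : AlgTensor X M} {C : ℝ} (h : ∀ l, ofList l = u → C ≤ cost l) :
    C ≤ projNorm u := by
  obtain ⟨l, hl⟩ := exists_ofList u
  have : Nonempty {l : List (X × M) // ofList l = u} := ⟨⟨l, hl⟩⟩
  exact le_ciInf fun l => h l.1 l.2

theorem projNorm_nonneg (u : AlgTensor X M) : 0 ≤ projNorm u :=
  le_projNorm fun l _ => cost_nonneg l

theorem projNorm_zero : projNorm (0 : AlgTensor X M) = 0 :=
  le_antisymm (projNorm_le (X := X) (M := M) []) (projNorm_nonneg _)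

theorem projNorm_add_le (u v : AlgTensor X M) :
    projNorm (u + v) ≤ projNorm u + projNorm v := by
  rw [← sub_le_iff_le_add']
  refine le_projNorm fun l' hl' => ?_
  rw [sub_le_comm]
  refine le_projNorm fun l hl => ?_
  rw [sub_le_iff_le_add]
  subst hl hl'
  have := projNorm_le (l ++ l')
  simpa [ofList, cost] using this

theorem ofList_smul (c : ℂ) (l : List (X × M)) :
    ofList (l.map fun p => (c • p.1, p.2)) = c • ofList l := by
  induction l with
  | nil => simp [ofList]
  | cons p l ih =>
    simp only [ofList, List.map_cons, List.sum_cons, smul_add] at ih ⊢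
    rw [ih]
    rfl

theorem projNorm_smul_le (c : ℂ) (u : AlgTensor X M) :
    projNorm (c • u) ≤ ‖c‖ * projNorm u := by
  rw [projNorm, projNorm, Real.mul_iInf_of_nonneg (norm_nonneg c)]
  obtain ⟨l, hl⟩ := exists_ofList u
  have : Nonempty {l : List (X × M) // ofList l = u} := ⟨⟨l, hl⟩⟩
  refine le_ciInf fun l => ?_
  obtain ⟨l, rfl⟩ := l
  refine (ciInf_le (bddBelow_cost _) ⟨_, ofList_smul c l⟩).trans (le_of_eq ?_)
  simp [cost, norm_smul, mul_assoc, List.sum_map_mul_left, Function.comp_def]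

/-- The projective norm as a seminorm. -/
def projSeminorm : Seminorm ℂ (AlgTensor X M) :=
  Seminorm.ofSMulLE projNorm projNorm_zero projNorm_add_le projNorm_smul_le

instance : SeminormedAddCommGroup (AlgTensor X M) :=
  AddGroupSeminorm.toSeminormedAddCommGroup
    (projSeminorm (X := X) (M := M)).toAddGroupSeminorm

theorem norm_def (u : AlgTensor X M) : ‖u‖ = projNorm u := rfl

instance : NormedSpace ℂ (AlgTensor X M) where
  norm_smul_le := projNorm_smul_le

/-- The linear map `f ⊗ id`. -/
def mapₗ (f : X →L[ℂ] Y) : AlgTensor X M →ₗ[ℂ] AlgTensor Y M :=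
  TensorProduct.map (f : X →ₗ[ℂ] Y) LinearMap.id

theorem mapₗ_mk (f : X →L[ℂ] Y) (x : X) (m : M) : mapₗ f (mk x m) = mk (f x) m := rfl

theorem norm_mapₗ_le (f : X →L[ℂ] Y) (u : AlgTensor X M) : ‖mapₗ f u‖ ≤ ‖f‖ * ‖u‖ := by
  rw [norm_def, norm_def, projNorm, projNorm, Real.mul_iInf_of_nonneg (norm_nonneg f)]
  obtain ⟨l, hl⟩ := exists_ofList u
  have : Nonempty {l : List (X × M) // ofList l = u} := ⟨⟨l, hl⟩⟩
  refine le_ciInf fun l => ?_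
  obtain ⟨l, rfl⟩ := l
  have h : ofList (l.map fun p => (f p.1, p.2)) = mapₗ f (ofList l) := by
    simp [ofList, map_list_sum, Function.comp_def, mapₗ_mk]
  refine (ciInf_le (bddBelow_cost _) ⟨_, h⟩).trans ?_
  simp only [cost, List.map_map, ← List.sum_map_mul_left]
  refine List.sum_le_sum fun p _ => ?_
  simp only [Function.comp_apply, ← mul_assoc]
  gcongr
  exact f.le_opNorm _

/-- The bounded linear map `f ⊗ id`. -/
def map (f : X →L[ℂ] Y) : AlgTensor X M →L[ℂ] AlgTensor Y M :=
  (mapₗ f).mkContinuous ‖f‖ (norm_mapₗ_le f)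

end AlgTensor

variable (X M) in
/-- The (completed) projective tensor product of `X` and `M`. -/
abbrev ProjTensor : Type _ := UniformSpace.Completion (AlgTensor X M)

namespace ProjTensor

/-- The elementary tensor `x ⊗ m`. -/
def mk (x : X) (m : M) : ProjTensor X M := ((AlgTensor.mk x m : AlgTensor X M) : ProjTensor X M)

/-- The bounded linear map `f ⊗ id` between projective tensor products. -/
def map (f : X →L[ℂ] Y) : ProjTensor X M →L[ℂ] ProjTensor Y M :=
  (AlgTensor.map f).completion

theorem map_mk (f : X →L[ℂ] Y) (x : X) (m : M) :
    map f (mk x m) = mk (f x) m :=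
  ContinuousLinearMap.completion_apply_coe _ _

end ProjTensor

/-! ### Balanced tensor products of bimodules and biflatness -/

section Balanced

variable {A : Type*} [NormedRing A] [NormedAlgebra ℂ A]

/-- The closed linear span of all `(x · a) ⊗ m - x ⊗ (a · m)` and `(a · x) ⊗ m - x ⊗ (m · a)`. -/
def balancedRelations (BX : BanachBimodule A X) (BM : BanachBimodule A M) :
    Submodule ℂ (ProjTensor X M) :=
  (Submodule.span ℂ
    ({t | ∃ a x m, t = ProjTensor.mk (BX.ract a x) m - ProjTensor.mk x (BM.lact a m)} ∪
     {t | ∃ a x m, t = ProjTensor.mk (BX.lact a x) m - ProjTensor.mk x (BM.ract a m)}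
    )).topologicalClosure

/-- The projective tensor product of two Banach `A`-bimodules, balanced on both sides
(that is, their tensor product over the enveloping algebra of `A`): the quotient of the
projective tensor product by the closed linear span of the balancing relations. -/
abbrev BimoduleTensor (BX : BanachBimodule A X) (BM : BanachBimodule A M) : Type _ :=
  ProjTensor X M ⧸ balancedRelations BX BM

theorem balancedRelations_le_comap {BX : BanachBimodule A X} {BY : BanachBimodule A Y}
    (BM : BanachBimodule A M) {f : X →L[ℂ] Y} (hf : BX.IsMap BY f) :
    balancedRelations BX BM ≤
      (balancedRelations BY BM).comap (ProjTensor.map (M := M) f).toLinearMap := by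
  refine Submodule.topologicalClosure_minimal _ ?_ ?_
  · rw [Submodule.span_le]
    rintro _ (⟨a, x, m, rfl⟩ | ⟨a, x, m, rfl⟩)
    · refine Submodule.le_topologicalClosure _ (Submodule.subset_span (Or.inl ⟨a, f x, m, ?_⟩))
      simp [ProjTensor.map_mk, hf.2]
    · refine Submodule.le_topologicalClosure _ (Submodule.subset_span (Or.inr ⟨a, f x, m, ?_⟩))
      simp [ProjTensor.map_mk, hf.1]
  · exact (Submodule.isClosed_topologicalClosure _).preimage (ProjTensor.map f).continuous

/-- The map `f ⊗ id` of balanced tensor products induced by a bimodule map `f`. -/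
def BimoduleTensor.map {BX : BanachBimodule A X} {BY : BanachBimodule A Y}
    (BM : BanachBimodule A M) (f : X →L[ℂ] Y) (hf : BX.IsMap BY f) :
    BimoduleTensor BX BM →ₗ[ℂ] BimoduleTensor BY BM :=
  Submodule.mapQ _ _ (ProjTensor.map (M := M) f).toLinearMap
    (balancedRelations_le_comap BM hf)

end Balanced

end ProjectiveTensor

/-- `0 → X → Y → Z → 0` is a short exact sequence that is admissible, i.e. it splits as a sequence
of Banach spaces and bounded linear maps. -/
def IsAdmissibleShortExact {X Y Z : Type*} [NormedAddCommGroup X] [NormedSpace ℂ X]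
    [NormedAddCommGroup Y] [NormedSpace ℂ Y] [NormedAddCommGroup Z] [NormedSpace ℂ Z]
    (f : X →L[ℂ] Y) (g : Y →L[ℂ] Z) : Prop :=
  Function.Injective f ∧ Function.Exact f g ∧ Function.Surjective g ∧
    (∃ r : Y →L[ℂ] X, ∀ x, r (f x) = x) ∧ ∃ s : Z →L[ℂ] Y, ∀ z, g (s z) = z

/-- A Banach `A`-bimodule `M` is biflat (flat as a Banach bimodule) if, for every admissible short
exact sequence `0 → X → Y → Z → 0` of Banach `A`-bimodules and bounded bimodule maps, the sequence
`0 → X ⊗ M → Y ⊗ M → Z ⊗ M → 0` of balanced tensor products is exact. -/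
def BanachBimodule.IsBiflat {A : Type u} [NormedRing A] [NormedAlgebra ℂ A]
    {M : Type v} [NormedAddCommGroup M] [NormedSpace ℂ M] (BM : BanachBimodule A M) : Prop :=
  ∀ (X Y Z : Type w) [NormedAddCommGroup X] [NormedSpace ℂ X] [CompleteSpace X]
    [NormedAddCommGroup Y] [NormedSpace ℂ Y] [CompleteSpace Y]
    [NormedAddCommGroup Z] [NormedSpace ℂ Z] [CompleteSpace Z]
    (BX : BanachBimodule A X) (BY : BanachBimodule A Y) (BZ : BanachBimodule A Z)
    (f : X →L[ℂ] Y) (g : Y →L[ℂ] Z) (hf : BX.IsMap BY f) (hg : BY.IsMap BZ g),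
    IsAdmissibleShortExact f g →
      Function.Injective (BimoduleTensor.map BM f hf) ∧
      Function.Exact (BimoduleTensor.map BM f hf) (BimoduleTensor.map BM g hg) ∧
      Function.Surjective (BimoduleTensor.map BM g hg)

end

/-! Write $A=\ell^1(\mathbb Z_+)$. In $\ell^1(\mathbb Z)$ each unit mass $\delta_k$ has an inverse
$\delta_{-k}$ of norm one. Hence for a bounded $u : A\to N'$ and $m\in N$ the sequence
$k\mapsto\langle u(\delta_k),\delta_{-k}m\rangle$ is bounded, and a Banach limit turns it into a
functional `average κ u` on $N$; here `κ` is either of the two actions. Three properties carry both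
halves of the theorem. Shift invariance makes the average equivariant (`average_comp_mul`). If $u$
is an orbit map, the sequence is constant and the average returns its value (`average_eq_of_const`).
Operators commuting with `κ`, in particular the action on the other side, pass through the average
(`average_comp_of_commute`).

For cohomology, averaging in the first variable of a cocycle gives a contracting homotopy in
positive degrees (`coboundary_contract`, `averagingContraction_homotopy`).

For biflatness, functionals on $X\mathbin{\widehat\otimes}_{A^e}N$ are the bounded bimodule maps
$X\to N'$. Exactness of the tensored sequence therefore follows once such maps extend along
admissible monomorphisms (`BanachBimodule.isBiflat_of_extension`). An extension is found by
composing with a bounded linear retraction and averaging over each side in turn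
(`BanachBimodule.exists_extension`).

The unit need not act as the identity: `κ 1` is only idempotent, and an average sees only its range.
On the complement `id - κ 1` the action is zero, and explicit correction terms handle it. -/

noncomputable section

/-! ### Banach limits -/

section BanachLimit

open Filter Topology BoundedContinuousFunction

/-- The mean of the first `K + 1` terms of a bounded sequence. -/
def cesaroMean (K : ℕ) : StrongDual ℂ (ℕ →ᵇ ℂ) :=
  ((K : ℂ) + 1)⁻¹ • ∑ k ∈ Finset.range (K + 1), BoundedContinuousFunction.evalCLM ℂ k

theorem cesaroMean_apply (K : ℕ) (u : ℕ →ᵇ ℂ) :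
    cesaroMean K u = ((K : ℂ) + 1)⁻¹ * ∑ k ∈ Finset.range (K + 1), u k := by
  simp [cesaroMean, _root_.sum_apply]

theorem norm_natCast_add_one (K : ℕ) : ‖(K : ℂ) + 1‖ = (K : ℝ) + 1 := by
  rw [← Nat.cast_add_one, Complex.norm_natCast, Nat.cast_add_one]

theorem norm_cesaroMean_le (K : ℕ) : ‖cesaroMean K‖ ≤ 1 := by
  refine ContinuousLinearMap.opNorm_le_bound _ zero_le_one fun u => ?_
  rw [cesaroMean_apply, norm_mul, norm_inv, norm_natCast_add_one, one_mul,
    inv_mul_le_iff₀ (by positivity)]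
  calc ‖∑ k ∈ Finset.range (K + 1), u k‖ ≤ ∑ k ∈ Finset.range (K + 1), ‖u‖ :=
        norm_sum_le_of_le _ fun k _ => u.norm_coe_le_norm k
    _ = ((K : ℝ) + 1) * ‖u‖ := by simp

/-- The difference telescopes to two boundary terms divided by `K + 1`, so the means are
asymptotically shift-invariant. -/
theorem norm_cesaroMean_shift_sub_le (K : ℕ) {u v : ℕ →ᵇ ℂ} (h : ∀ k, v k = u (k + 1)) :
    ‖cesaroMean K v - cesaroMean K u‖ ≤ 2 * ‖u‖ * (1 / ((K : ℝ) + 1)) := by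
  have : cesaroMean K v - cesaroMean K u = ((K : ℂ) + 1)⁻¹ * (u (K + 1) - u 0) := by
    rw [cesaroMean_apply, cesaroMean_apply, ← mul_sub, ← Finset.sum_sub_distrib,
      ← Finset.sum_range_sub (fun k => u k)]
    simp [h]
  rw [this, norm_mul, norm_inv, norm_natCast_add_one, one_div, mul_comm]
  gcongr
  calc ‖u (K + 1) - u 0‖ ≤ ‖u‖ + ‖u‖ :=
        norm_sub_le_of_le (u.norm_coe_le_norm _) (u.norm_coe_le_norm _)
    _ = 2 * ‖u‖ := by ring

/-- There is a Banach limit: a continuous shift-invariant functional on bounded sequences that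
takes the value `1` at the constant sequence `1`. -/
theorem exists_banachLimit : ∃ Λ : StrongDual ℂ (ℕ →ᵇ ℂ),
    (∀ u v : ℕ →ᵇ ℂ, (∀ k, v k = u (k + 1)) → Λ v = Λ u) ∧ Λ (const ℕ 1) = 1 := by
  -- By Banach–Alaoglu, the means, which all lie in the unit ball, converge weak-* along any
  -- ultrafilter.
  have hc := WeakDual.isCompact_closedBall (𝕜 := ℂ) (0 : StrongDual ℂ (ℕ →ᵇ ℂ)) 1
  obtain ⟨Λ, -, hΛ⟩ := hc.ultrafilter_le_nhds
    ((hyperfilter ℕ).map fun K => StrongDual.toWeakDual (cesaroMean K))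
    (by
      rw [Ultrafilter.coe_map, le_principal_iff, mem_map]
      exact univ_mem' fun K => by simpa using norm_cesaroMean_le K)
  have key : ∀ u : ℕ →ᵇ ℂ, Tendsto (fun K => cesaroMean K u) (hyperfilter ℕ) (𝓝 (Λ u)) :=
    fun u => ((WeakDual.eval_continuous u).tendsto Λ).comp hΛ
  refine ⟨WeakDual.toStrongDual Λ, fun u v h => ?_, ?_⟩
  · have h0 : Tendsto (fun K => cesaroMean K v - cesaroMean K u) (hyperfilter ℕ) (𝓝 0) := by
      refine squeeze_zero_norm (fun K => norm_cesaroMean_shift_sub_le K h) ?_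
      have := (tendsto_one_div_add_atTop_nhds_zero_nat (𝕜 := ℝ)).const_mul (2 * ‖u‖)
      rw [mul_zero] at this
      -- Non-principality of the ultrafilter matters here: limits at infinity are also limits along
      -- it.
      exact this.mono_left (Nat.hyperfilter_le_atTop)
    exact sub_eq_zero.1 (tendsto_nhds_unique ((key v).sub (key u)) h0)
  · refine tendsto_nhds_unique (key _) (tendsto_const_nhds.congr fun K => ?_)
    have : (K : ℂ) + 1 ≠ 0 := Nat.cast_add_one_ne_zero K
    simp [cesaroMean_apply, this]

/-- A choice of Banach limit. -/
def banachLimit : StrongDual ℂ (ℕ →ᵇ ℂ) := exists_banachLimit.choose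

theorem banachLimit_shift {u v : ℕ →ᵇ ℂ} (h : ∀ k, v k = u (k + 1)) :
    banachLimit v = banachLimit u := exists_banachLimit.choose_spec.1 u v h

theorem banachLimit_shift_nat (j : ℕ) : ∀ {u v : ℕ →ᵇ ℂ}, (∀ k, v k = u (k + j)) →
    banachLimit v = banachLimit u := by
  induction j with
  | zero =>
    intro u v h
    congr 1
    ext k
    exact h k
  | succ j ih =>
    intro u v h
    let t : ℕ →ᵇ ℂ := u.compContinuous ⟨fun k => k + 1, continuous_of_discreteTopology⟩
    exact (ih (u := t) fun k => h k).trans (banachLimit_shift fun k => rfl)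

theorem banachLimit_of_const {u : ℕ →ᵇ ℂ} {c : ℂ} (h : ∀ k, u k = c) : banachLimit u = c := by
  have : u = c • const ℕ 1 := by
    ext k
    simp [h]
  rw [this, map_smul, banachLimit, exists_banachLimit.choose_spec.2, smul_eq_mul, mul_one]

end BanachLimit

/-! ### Unit masses -/

namespace Ell1

variable {S : Type*}

/-- The unit mass at `s`. -/
def delta (s : S) : Ell1 S := open Classical in lp.single 1 s 1

open Classical in
theorem delta_apply (s t : S) : delta s t = if t = s then 1 else 0 := by
  rw [delta, lp.single_apply, Pi.single_apply]

theorem norm_delta (s : S) : ‖delta s‖ = 1 := by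
  classical
  rw [delta, lp.norm_single (by simp)]
  simp

theorem delta_zero [AddMonoid S] : delta (0 : S) = 1 := rfl

theorem delta_add [AddCommMonoid S] (s t : S) : delta (s + t) = delta s * delta t := by
  classical
  ext r
  rw [mul_apply_eq, tsum_eq_single (s, t), delta_apply]
  · simp [delta_apply, eq_comm]
  · rintro ⟨a, b⟩ h
    by_cases ha : a = s
    · have : b ≠ t := fun hb => h (by rw [ha, hb])
      simp [delta_apply, this]
    · simp [delta_apply, ha]

/-- The unit masses span a dense subspace of $\ell^1$, so identities between bounded maps need only
be tested on them. -/
theorem ext_delta {E : Type*} [NormedAddCommGroup E] [NormedSpace ℂ E] {f g : Ell1 S →L[ℂ] E}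
    (h : ∀ s, f (delta s) = g (delta s)) : f = g := by
  classical
  refine lp.ext_continuousLinearMap ENNReal.one_ne_top fun s => ?_
  ext
  simpa [delta] using h s

theorem incl_delta (k : ℕ) : incl (delta k) = delta (k : ℤ) := by
  ext j
  rw [incl_apply, delta_apply, delta_apply]
  split_ifs <;> first | rfl | omega

end Ell1

/-! ### Averaging over `ℓ¹(ℤ₊)` -/

section Averaging

open BoundedContinuousFunction Ell1

variable {N : Type*} [NormedAddCommGroup N] [NormedSpace ℂ N]

/-- All unit masses, with negative index too, have norm one, so the bound is uniform in `k` even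
when the action is not contractive. -/
theorem norm_apply_delta_le (κ : Ell1 ℤ →L[ℂ] N →L[ℂ] N) (u : Ell1 ℕ →L[ℂ] StrongDual ℂ N)
    (m : N) (k : ℕ) : ‖u (delta k) (κ (delta (-(k : ℤ))) m)‖ ≤ ‖u‖ * (‖κ‖ * ‖m‖) :=
  calc ‖u (delta k) (κ (delta (-(k : ℤ))) m)‖
      ≤ ‖u (delta k)‖ * ‖κ (delta (-(k : ℤ))) m‖ := (u (delta k)).le_opNorm _
    _ ≤ (‖u‖ * ‖delta k‖) * (‖κ‖ * ‖delta (-(k : ℤ))‖ * ‖m‖) := by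
      gcongr
      · exact u.le_opNorm _
      · exact κ.le_opNorm₂ _ _
    _ = ‖u‖ * (‖κ‖ * ‖m‖) := by simp [norm_delta]

/-- `k ↦ ⟨u(δ_k), δ_{-k} m⟩` -/
def averagingSeq (κ : Ell1 ℤ →L[ℂ] N →L[ℂ] N) (u : Ell1 ℕ →L[ℂ] StrongDual ℂ N) (m : N) :
    ℕ →ᵇ ℂ :=
  ofNormedAddCommGroupDiscrete (fun k => u (delta k) (κ (delta (-(k : ℤ))) m))
    (‖u‖ * (‖κ‖ * ‖m‖)) (norm_apply_delta_le κ u m)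

theorem averagingSeq_apply (κ : Ell1 ℤ →L[ℂ] N →L[ℂ] N) (u : Ell1 ℕ →L[ℂ] StrongDual ℂ N)
    (m : N) (k : ℕ) : averagingSeq κ u m k = u (delta k) (κ (delta (-(k : ℤ))) m) := rfl

theorem norm_averagingSeq_le (κ : Ell1 ℤ →L[ℂ] N →L[ℂ] N) (u : Ell1 ℕ →L[ℂ] StrongDual ℂ N)
    (m : N) : ‖averagingSeq κ u m‖ ≤ ‖u‖ * (‖κ‖ * ‖m‖) :=
  (norm_le (by positivity)).2 (norm_apply_delta_le κ u m)

/-- The average of `u(δ_k) ∘ κ(δ_{-k})`. -/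
def average (κ : Ell1 ℤ →L[ℂ] N →L[ℂ] N) :
    (Ell1 ℕ →L[ℂ] StrongDual ℂ N) →L[ℂ] StrongDual ℂ N :=
  LinearMap.mkContinuous₂
    (LinearMap.mk₂ ℂ (fun u m => banachLimit (averagingSeq κ u m))
      (fun u u' m => by
        rw [← map_add]
        congr 1)
      (fun c u m => by
        rw [← map_smul]
        congr 1)
      (fun u m m' => by
        rw [← map_add]
        congr 1
        ext k
        simp [averagingSeq_apply])
      (fun c u m => by
        rw [← map_smul]
        congr 1
        ext k
        simp [averagingSeq_apply]))
    (‖banachLimit‖ * ‖κ‖) (fun u m => by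
      calc ‖banachLimit (averagingSeq κ u m)‖ ≤ ‖banachLimit‖ * ‖averagingSeq κ u m‖ :=
            banachLimit.le_opNorm _
        _ ≤ ‖banachLimit‖ * (‖u‖ * (‖κ‖ * ‖m‖)) := by
          gcongr
          exact norm_averagingSeq_le κ u m
        _ = ‖banachLimit‖ * ‖κ‖ * ‖u‖ * ‖m‖ := by ring)

theorem average_apply (κ : Ell1 ℤ →L[ℂ] N →L[ℂ] N) (u : Ell1 ℕ →L[ℂ] StrongDual ℂ N) (m : N) :
    average κ u m = banachLimit (averagingSeq κ u m) := rfl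

variable {κ : Ell1 ℤ →L[ℂ] N →L[ℂ] N}

/-- Both sides are bounded and linear in `a`, so take $a=\delta_j$. Since
$\delta_{-k}=\delta_{-(k+j)}\delta_j$, the sequence averaged on the left is the one on the right
shifted by `j`. -/
theorem average_comp_mul (hκ : ∀ a b m, κ (a * b) m = κ a (κ b m))
    (u : Ell1 ℕ →L[ℂ] StrongDual ℂ N) (a : Ell1 ℕ) :
    average κ (u.comp (ContinuousLinearMap.mul ℂ (Ell1 ℕ) a)) = (average κ u).comp (κ (incl a)) := by
  let F : Ell1 ℕ →L[ℂ] StrongDual ℂ N :=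
    (average κ).comp ((ContinuousLinearMap.compL ℂ _ _ _ u).comp
      (ContinuousLinearMap.mul ℂ (Ell1 ℕ)))
  let G : Ell1 ℕ →L[ℂ] StrongDual ℂ N :=
    (ContinuousLinearMap.compL ℂ N N ℂ (average κ u)).comp
      (κ.comp incl.toContinuousLinearMap)
  suffices h : F = G from DFunLike.congr_fun h a
  refine ext_delta fun j => ?_
  ext m
  change banachLimit _ = banachLimit _
  refine banachLimit_shift_nat j fun k => ?_
  change u (delta j * delta k) _ = u (delta (k + j)) (κ _ (κ (incl (delta j)) m))
  rw [← hκ, incl_delta, ← delta_add, ← delta_add, add_comm j k]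
  congr 4
  push_cast
  ring

/-- The factor $\delta_k$ supplied by `u` cancels $\delta_{-k}$, so every term equals `ψ (κ 1 m)`.
The factor `κ 1` stays because the unit may act as a proper idempotent. -/
theorem average_eq_of_const (u : Ell1 ℕ →L[ℂ] StrongDual ℂ N)
    (hκ : ∀ a b m, κ (a * b) m = κ a (κ b m)) {ψ : StrongDual ℂ N}
    (h : ∀ b, u b = ψ.comp (κ (incl b))) : average κ u = ψ.comp (κ 1) := by
  ext m
  refine banachLimit_of_const fun k => ?_
  rw [averagingSeq_apply, h, ContinuousLinearMap.comp_apply, ← hκ, incl_delta, ← delta_add,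
    add_neg_cancel, delta_zero, ContinuousLinearMap.comp_apply]

/-- `V` moves past $\delta_{-k}$ in each term. It is used with `V` the action on the opposite side.
-/
theorem average_comp_of_commute (u v : Ell1 ℕ →L[ℂ] StrongDual ℂ N) {V : N →L[ℂ] N}
    (hV : ∀ a m, V (κ a m) = κ a (V m)) (h : ∀ b, v b = (u b).comp V) :
    average κ v = (average κ u).comp V := by
  ext m
  rw [ContinuousLinearMap.comp_apply, average_apply, average_apply]
  congr 1
  ext k
  rw [averagingSeq_apply, averagingSeq_apply, h, ContinuousLinearMap.comp_apply, hV]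

end Averaging

/-! ### Vanishing of cohomology -/

namespace Hochschild

variable {A : Type*} [NormedRing A]
theorem contractNth_zero_cons {n : ℕ} (b : A) (a : Fin (n + 1) → A) :
    Fin.contractNth 0 (· * ·) (Fin.cons b a : Fin (n + 2) → A) =
      Fin.cons (b * a 0) (Fin.tail a) := by
  ext l
  refine Fin.cases ?_ (fun l => ?_) l
  · rfl
  · rw [Fin.contractNth_apply_of_gt _ _ _ _ (by simp)]
    rfl

theorem contractNth_succ_cons {n : ℕ} (j : Fin n) (b : A) (a : Fin (n + 1) → A) :
    (j.succ).castSucc.contractNth (· * ·) (Fin.cons b a : Fin (n + 2) → A) =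
      Fin.cons b (j.castSucc.contractNth (· * ·) a) := by
  ext l
  refine Fin.cases rfl (fun l => ?_) l
  change Fin.contractNth _ _ _ l.succ = Fin.contractNth _ _ _ l
  rcases lt_trichotomy (l : ℕ) j with h | h | h
  · rw [Fin.contractNth_apply_of_lt _ _ _ _ (by simpa using h),
      Fin.contractNth_apply_of_lt _ _ _ _ (by simpa using h)]
    rfl
  · rw [Fin.contractNth_apply_of_eq _ _ _ _ (by simpa using h),
      Fin.contractNth_apply_of_eq _ _ _ _ (by simpa using h)]
    rfl
  · rw [Fin.contractNth_apply_of_gt _ _ _ _ (by simpa using h),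
      Fin.contractNth_apply_of_gt _ _ _ _ (by simpa using h)]
    rfl

variable [NormedAlgebra ℂ A]
variable {M : Type*} [NormedAddCommGroup M] [NormedSpace ℂ M]

/-- The cochain `(a₁, …, aₙ) ↦ D (b ↦ ψ(b, a₁, …, aₙ))`. -/
def contract (D : (A →L[ℂ] M) →L[ℂ] M) {n : ℕ} (ψ : Cochain A M (n + 1)) : Cochain A M n :=
  D.compContinuousMultilinearMap (ContinuousLinearMap.flipMultilinear
    (ContinuousMultilinearMap.curryLeft (Ei := fun _ : Fin (n + 1) => A) ψ))

/-- The map `b ↦ ψ(b, a₁, …, aₙ)`. -/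
def slice {n : ℕ} (ψ : Cochain A M (n + 1)) (a : Fin n → A) : A →L[ℂ] M :=
  ContinuousLinearMap.flipMultilinear
    (ContinuousMultilinearMap.curryLeft (Ei := fun _ : Fin (n + 1) => A) ψ) a

theorem slice_apply {n : ℕ} (ψ : Cochain A M (n + 1)) (a : Fin n → A) (b : A) :
    slice ψ a b = ψ (Fin.cons b a) := rfl

theorem contract_apply (D : (A →L[ℂ] M) →L[ℂ] M) {n : ℕ} (ψ : Cochain A M (n + 1))
    (a : Fin n → A) : contract D ψ a = D (slice ψ a) := rfl

/-- The coboundary of `ψ` at `(b, a₁, …, aₙ₊₁)` in terms of the coboundary of `ψ(b, ·)`. -/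
theorem slice_coboundary (B : BanachBimodule A M) {n : ℕ} (ψ : Cochain A M (n + 1))
    (a : Fin (n + 1) → A) :
    slice (coboundary B (n + 1) ψ) a =
      B.lact.flip (ψ a) - (slice ψ (Fin.tail a)).comp ((ContinuousLinearMap.mul ℂ A).flip (a 0))
        - ∑ j : Fin n, (-1 : ℂ) ^ ((j : ℕ) + 1) • slice ψ (j.castSucc.contractNth (· * ·) a)
        - (-1 : ℂ) ^ (n + 1) • (B.ract (a (Fin.last n))).comp (slice ψ (Fin.init a)) := by
  ext b
  have hinit : (Fin.init (Fin.cons b a : Fin (n + 2) → A) : Fin (n + 1) → A) =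
      Fin.cons b (Fin.init a) := by
    ext l
    exact Fin.cases rfl (fun l => rfl) l
  have hlast : (Fin.cons b a : Fin (n + 2) → A) (Fin.last (n + 1)) = a (Fin.last n) := rfl
  have h0 := contractNth_zero_cons b a
  -- The face `j = 0` multiplies `b` into `a 0`. The remaining faces are those of `a` with index
  -- raised by one, which reverses their signs.
  rw [slice_apply, coboundary_apply, Fin.sum_univ_succ, hinit, hlast]
  simp only [contractNth_succ_cons, Fin.castSucc_zero, h0, Fin.tail_cons, Fin.cons_zero,
    sub_apply, sum_apply, smul_apply, ContinuousLinearMap.comp_apply, slice_apply,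
    ContinuousLinearMap.flip_apply, ContinuousLinearMap.mul_apply', Fin.val_succ, Fin.val_zero,
    pow_succ, pow_zero]
  simp only [mul_neg, mul_one, neg_smul, neg_neg, one_smul, Finset.sum_neg_distrib]
  abel

/-- A cocycle is the coboundary of its contraction by `D` if `D` is a right module map that
satisfies the homotopy relation. -/
theorem coboundary_contract (B : BanachBimodule A M) {D : (A →L[ℂ] M) →L[ℂ] M}
    (hr : ∀ a u, D ((B.ract a).comp u) = B.ract a (D u))
    (hh : ∀ (u : A →L[ℂ] M) (a : A),
      D (B.lact.flip (u a)) - D (u.comp ((ContinuousLinearMap.mul ℂ A).flip a)) + B.lact a (D u)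
        = u a)
    {n : ℕ} {ψ : Cochain A M (n + 1)} (hψ : coboundary B (n + 1) ψ = 0) :
    coboundary B n (contract D ψ) = ψ := by
  ext a
  -- Applying `D` to the cocycle identity expresses `D (b ↦ b · ψ a)` through the other terms.
  -- Substituted into the homotopy relation for `slice ψ (Fin.tail a)`, it leaves exactly the
  -- coboundary of `contract D ψ`.
  have h1 : D (slice (coboundary B (n + 1) ψ) a) = 0 := by
    rw [← contract_apply, hψ]
    change D 0 = 0
    exact map_zero D
  have h2 : slice ψ (Fin.tail a) (a 0) = ψ a := by
    rw [slice_apply, Fin.cons_self_tail]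
  have h3 := hh (slice ψ (Fin.tail a)) (a 0)
  rw [slice_coboundary] at h1
  simp only [map_sub, map_sum, map_smul, hr] at h1
  rw [h2] at h3
  simp only [coboundary_apply, contract_apply]
  rw [sub_sub, sub_eq_zero] at h1
  rw [h1] at h3
  rw [← h3]
  abel

end Hochschild

/-! ### The averaging homotopy for the dual bimodule -/

namespace BanachBimodule

open Ell1

variable {N : Type*} [NormedAddCommGroup N] [NormedSpace ℂ N] (B : BanachBimodule (Ell1 ℤ) N)

/-- `u ↦ D u - p (u x)` -/
def subEval {E F : Type*} [NormedAddCommGroup E] [NormedSpace ℂ E] [NormedAddCommGroup F]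
    [NormedSpace ℂ F] (D : (E →L[ℂ] F) →L[ℂ] F) (p : F →L[ℂ] F) (x : E) :
    (E →L[ℂ] F) →L[ℂ] F :=
  D - p.comp (ContinuousLinearMap.apply ℂ F x)

/-- The averaging contraction on `N'`, corrected on the part where the unit acts as zero. -/
def averagingContraction : (Ell1 ℕ →L[ℂ] StrongDual ℂ N) →L[ℂ] StrongDual ℂ N :=
  subEval (average B.ract)
    ((ContinuousLinearMap.compL ℂ N N ℂ).flip (ContinuousLinearMap.id ℂ N - B.ract 1)) 1

theorem averagingContraction_apply (u : Ell1 ℕ →L[ℂ] StrongDual ℂ N) :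
    B.averagingContraction u =
      average B.ract u - (u 1).comp (ContinuousLinearMap.id ℂ N - B.ract 1) := rfl

/-- By commutativity of $\ell^1(\mathbb Z)$ the right action is also multiplicative in the left-hand
order, so it can serve as `κ`. -/
theorem ract_mul_comm (a b : Ell1 ℤ) (m : N) : B.ract (a * b) m = B.ract a (B.ract b m) := by
  rw [mul_comm, B.ract_mul]

/-- The right action on $N'$ is the transpose of the left action on $N$, which commutes with the
action `B.ract` being averaged and with the idempotent `B.ract 1`. -/
theorem averagingContraction_ract (a : Ell1 ℕ) (u : Ell1 ℕ →L[ℂ] StrongDual ℂ N) :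
    B.averagingContraction (((B.restrict incl).dual.ract a).comp u) =
      (B.restrict incl).dual.ract a (B.averagingContraction u) := by
  have h := average_comp_of_commute (κ := B.ract) u (((B.restrict incl).dual.ract a).comp u)
    (V := B.lact (incl a)) (fun b m => B.lact_ract _ _ _) (fun b => rfl)
  rw [averagingContraction_apply, averagingContraction_apply, h]
  ext m
  change _ - u 1 (B.lact _ (m - B.ract 1 m)) =
    average B.ract u (B.lact _ m) - u 1 (B.lact _ m - B.ract 1 (B.lact _ m))
  rw [map_sub, B.lact_ract]
  rfl

/-- Put `P = B.ract 1`. The first term gives `u a ∘ P`, its correction vanishing because `P` is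
idempotent. The averages in the other two terms cancel by equivariance, and the correction in the
second contributes the missing `u a ∘ (id - P)`. In the third the correction vanishes because `P`
fixes the range of the action. -/
theorem averagingContraction_homotopy (u : Ell1 ℕ →L[ℂ] StrongDual ℂ N) (a : Ell1 ℕ) :
    B.averagingContraction ((B.restrict incl).dual.lact.flip (u a))
      - B.averagingContraction (u.comp ((ContinuousLinearMap.mul ℂ (Ell1 ℕ)).flip a))
      + (B.restrict incl).dual.lact a (B.averagingContraction u) = u a := by
  have h1 := average_eq_of_const (κ := B.ract) ((B.restrict incl).dual.lact.flip (u a))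
    B.ract_mul_comm (ψ := u a) (fun b => rfl)
  have h2 := average_comp_mul B.ract_mul_comm u a
  have h3 : u.comp ((ContinuousLinearMap.mul ℂ (Ell1 ℕ)).flip a) =
      u.comp (ContinuousLinearMap.mul ℂ (Ell1 ℕ) a) := by
    ext b : 1
    simp
  simp only [averagingContraction_apply]
  rw [h1, h3, h2]
  ext m
  have e1 : B.ract 1 (B.ract (incl a) m) = B.ract (incl a) m := by
    rw [← B.ract_mul, mul_one]
  have e2 : B.ract 1 (B.ract 1 m) = B.ract 1 m := by
    rw [← B.ract_mul, mul_one]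
  change (u a (B.ract 1 m) - u a (B.ract (incl 1) (m - B.ract 1 m))) -
    (average B.ract u (B.ract (incl a) m) - u (a * 1) (m - B.ract 1 m)) +
    (average B.ract u (B.ract (incl a) m) -
      u 1 (B.ract (incl a) m - B.ract 1 (B.ract (incl a) m))) = u a m
  rw [map_one incl, map_sub (B.ract 1), e1, e2, mul_one, sub_self, sub_self, map_zero, map_zero, map_sub]
  ring

theorem subsingleton_cohomology_dual (n : ℕ) :
    Subsingleton (Hochschild.Cohomology (B.restrict incl).dual (n + 1)) := by
  refine Submodule.Quotient.subsingleton_iff.2 (eq_top_iff.2 ?_)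
  rintro ⟨ψ, hψ⟩ -
  exact ⟨_, Hochschild.coboundary_contract _ B.averagingContraction_ract
    B.averagingContraction_homotopy hψ⟩

end BanachBimodule

/-! ### Extension of bimodule maps into the dual bimodule -/

section Intertwine

open Ell1

variable {N : Type*} [NormedAddCommGroup N] [NormedSpace ℂ N]
variable {Y : Type*} [NormedAddCommGroup Y] [NormedSpace ℂ Y]
variable (κ : Ell1 ℤ →L[ℂ] N →L[ℂ] N) (ρ : Ell1 ℕ →L[ℂ] Y →L[ℂ] Y)

/-- Averages `T : Y → N'` to a map that intertwines `ρ` with the transpose of `κ`. -/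
def intertwine (T : Y →L[ℂ] StrongDual ℂ N) : Y →L[ℂ] StrongDual ℂ N :=
  (average κ).comp ((ContinuousLinearMap.compL ℂ (Ell1 ℕ) Y (StrongDual ℂ N) T).comp ρ.flip) +
    ((ContinuousLinearMap.compL ℂ N N ℂ).flip (ContinuousLinearMap.id ℂ N - κ 1)).comp
      (T.comp (ContinuousLinearMap.id ℂ Y - ρ 1))

theorem intertwine_apply (T : Y →L[ℂ] StrongDual ℂ N) (y : Y) :
    intertwine κ ρ T y = average κ (T.comp (ρ.flip y)) +
      (T (y - ρ 1 y)).comp (ContinuousLinearMap.id ℂ N - κ 1) := rfl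

variable {κ ρ}

/-- The averaged term is equivariant by shift invariance. The correction vanishes on both sides,
since `ρ 1` fixes `ρ a y` and `κ 1` fixes the range of `κ (incl a)`. -/
theorem intertwine_map (hκ : ∀ a b m, κ (a * b) m = κ a (κ b m))
    (hρ : ∀ a b y, ρ (a * b) y = ρ a (ρ b y)) (T : Y →L[ℂ] StrongDual ℂ N) (a : Ell1 ℕ) (y : Y) :
    intertwine κ ρ T (ρ a y) = (intertwine κ ρ T y).comp (κ (incl a)) := by
  have h1 : T.comp (ρ.flip (ρ a y)) =
      (T.comp (ρ.flip y)).comp (ContinuousLinearMap.mul ℂ (Ell1 ℕ) a) := by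
    ext b : 1
    change T (ρ b (ρ a y)) = T (ρ (a * b) y)
    rw [mul_comm, hρ]
  rw [intertwine_apply, intertwine_apply, h1, average_comp_mul hκ, ← hρ, one_mul, sub_self,
    map_zero, ContinuousLinearMap.zero_comp, add_zero]
  ext m
  change _ = average κ _ (κ (incl a) m) + T (y - ρ 1 y) (κ (incl a) m - κ 1 (κ (incl a) m))
  rw [← hκ, one_mul, sub_self, map_zero, add_zero]
  rfl

/-- The average recovers `T y ∘ κ 1` and the correction supplies `T y ∘ (id - κ 1)`. Equivariance is
needed only at the given `y`, so the lemma applies on the image of `f`, where `T ∘ r` is already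
equivariant. -/
theorem intertwine_eq_self (hκ : ∀ a b m, κ (a * b) m = κ a (κ b m))
    {T : Y →L[ℂ] StrongDual ℂ N} {y : Y} (h : ∀ a, T (ρ a y) = (T y).comp (κ (incl a))) :
    intertwine κ ρ T y = T y := by
  rw [intertwine_apply, average_eq_of_const (κ := κ) _ hκ (ψ := T y) h, map_sub, h, map_one incl]
  ext m
  change T y (κ 1 m) + (T y (m - κ 1 m) - T y (κ 1 (m - κ 1 m))) = T y m
  rw [map_sub (κ 1), ← hκ, mul_one, sub_self, map_zero, map_sub]
  ring

/-- Averaging over one action does not destroy equivariance for a commuting one, which permits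
averaging over the two sides successively. -/
theorem intertwine_of_commute {T : Y →L[ℂ] StrongDual ℂ N} {U : Y →L[ℂ] Y} {V : N →L[ℂ] N}
    (hT : ∀ y, T (U y) = (T y).comp V) (hU : ∀ a y, U (ρ a y) = ρ a (U y))
    (hV : ∀ a m, V (κ a m) = κ a (V m)) (y : Y) :
    intertwine κ ρ T (U y) = (intertwine κ ρ T y).comp V := by
  rw [intertwine_apply, intertwine_apply, average_comp_of_commute (T.comp (ρ.flip y)) _ hV, ← hU,
    ← map_sub U, hT]
  · ext m
    change _ + T _ (V (m - κ 1 m)) = _ + T _ (V m - κ 1 (V m))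
    rw [map_sub V, hV]
    rfl
  · intro b
    change T (ρ b (U y)) = (T (ρ b y)).comp V
    rw [← hU, hT]

/-- Bimodule maps into the dual of a Banach `ℓ¹(ℤ)`-bimodule extend along admissible
monomorphisms of Banach `ℓ¹(ℤ₊)`-bimodules. -/
theorem BanachBimodule.exists_extension {X : Type*} [NormedAddCommGroup X] [NormedSpace ℂ X]
    (B : BanachBimodule (Ell1 ℤ) N) {BX : BanachBimodule (Ell1 ℕ) X}
    {BY : BanachBimodule (Ell1 ℕ) Y} {f : X →L[ℂ] Y} (hf : BX.IsMap BY f) {r : Y →L[ℂ] X}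
    (hr : ∀ x, r (f x) = x) {T : X →L[ℂ] StrongDual ℂ N}
    (hT : BX.IsMap (B.restrict incl).dual T) :
    ∃ T' : Y →L[ℂ] StrongDual ℂ N, BY.IsMap (B.restrict incl).dual T' ∧ ∀ x, T' (f x) = T x := by
  have hl (a : Ell1 ℕ) (x : X) : T (BX.lact a x) = (T x).comp (B.ract (incl a)) := hT.1 a x
  have hr' (a : Ell1 ℕ) (x : X) : T (BX.ract a x) = (T x).comp (B.lact (incl a)) := hT.2 a x
  have hρ (a b y) : BY.ract (a * b) y = BY.ract a (BY.ract b y) := by rw [mul_comm, BY.ract_mul]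
  -- `T ∘ r` extends `T` but is only linear. Averaging over the right action of `Y` is paired with
  -- `B.lact`, because the right action on the dual is its transpose.
  have h1 (x : X) : intertwine B.lact BY.ract (T.comp r) (f x) = T x := by
    rw [intertwine_eq_self B.lact_mul]
    · simp [hr]
    · intro a
      simp [← hf.2, hr, hr']
  refine ⟨intertwine B.ract BY.lact (intertwine B.lact BY.ract (T.comp r)),
    ⟨fun a y => intertwine_map B.ract_mul_comm BY.lact_mul _ a y, fun a y => ?_⟩, fun x => ?_⟩
  · exact intertwine_of_commute (fun y => intertwine_map B.lact_mul hρ _ a y)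
      (fun b y => (BY.lact_ract b a y).symm) (fun b m => B.lact_ract _ b m) y
  · rw [intertwine_eq_self B.ract_mul_comm, h1]
    intro a
    rw [← hf.1, h1, h1, hl]

end Intertwine

/-! ### Exactness from the dual sequence -/

section DualSequence

variable {E F G : Type*} [NormedAddCommGroup E] [NormedSpace ℂ E]
  [NormedAddCommGroup F] [NormedSpace ℂ F] [NormedAddCommGroup G] [NormedSpace ℂ G]

/-- The open mapping theorem for the adjoint lifts a norming functional of `x` to some `ψ` of norm
at most `C`, whence `‖x‖ = ‖ψ (f x)‖ ≤ C * ‖f x‖`. -/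
theorem ContinuousLinearMap.antilipschitz_of_dual_surjective {f : E →L[ℂ] F}
    (hf : ∀ φ : StrongDual ℂ E, ∃ ψ : StrongDual ℂ F, ψ.comp f = φ) :
    ∃ C, AntilipschitzWith C f := by
  let f' : StrongDual ℂ F →L[ℂ] StrongDual ℂ E := (ContinuousLinearMap.compL ℂ E F ℂ).flip f
  obtain ⟨C, hC, h⟩ := f'.exists_preimage_norm_le hf
  refine ⟨⟨C, hC.le⟩, f.antilipschitz_of_bound fun x => ?_⟩
  obtain ⟨φ, hφ, hx⟩ := exists_dual_vector'' ℂ x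
  obtain ⟨ψ, rfl, hψ⟩ := h φ
  calc ‖x‖ = ‖ψ (f x)‖ := by
        change ψ (f x) = _ at hx
        rw [hx]
        simp
    _ ≤ ‖ψ‖ * ‖f x‖ := ψ.le_opNorm _
    _ ≤ C * ‖f x‖ := by
        gcongr
        exact hψ.trans (mul_le_of_le_one_right hC.le hφ)

/-- Hahn–Banach in `F ⧸ S`, a normed space because `S` is closed. -/
theorem Submodule.exists_dual_separating {S : Submodule ℂ F} (hS : IsClosed (S : Set F)) {y : F}
    (hy : y ∉ S) : ∃ ψ : StrongDual ℂ F, (∀ s ∈ S, ψ s = 0) ∧ ψ y ≠ 0 := by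
  have hy' : S.mkQ y ≠ 0 := by simpa using hy
  obtain ⟨φ, -, hφ⟩ := exists_dual_vector ℂ (S.mkQ y) (norm_ne_zero_iff.2 hy')
  refine ⟨φ.comp S.mkQL, fun s hs => ?_, ?_⟩
  · have : S.mkQ s = 0 := by simpa using hs
    change φ (S.mkQ s) = 0
    rw [this, map_zero]
  · change φ (S.mkQ y) ≠ 0
    rw [hφ]
    simpa using hy'

/-- A complex `E → F → G` of Banach spaces with `0 ← E' ← F' ← G'` exact is exact at `E` and at
`F`. -/
theorem ContinuousLinearMap.exact_of_dual_exact [CompleteSpace E] {f : E →L[ℂ] F} {g : F →L[ℂ] G}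
    (hgf : g.comp f = 0)
    (hf : ∀ φ : StrongDual ℂ E, ∃ ψ : StrongDual ℂ F, ψ.comp f = φ)
    (hg : ∀ ψ : StrongDual ℂ F, ψ.comp f = 0 → ∃ χ : StrongDual ℂ G, χ.comp g = ψ) :
    Function.Injective f ∧ Function.Exact f g := by
  obtain ⟨C, hC⟩ := antilipschitz_of_dual_surjective hf
  refine ⟨hC.injective, fun y => ⟨fun hy => ?_, ?_⟩⟩
  · by_contra h
    -- The lower bound on `f` and completeness of `E` make the range closed, so a point outside it
    -- can be separated from it.
    have hcl : IsClosed (f.range : Set F) :=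
      hC.isClosed_range f.uniformContinuous
    obtain ⟨ψ, hψ, hψy⟩ := Submodule.exists_dual_separating hcl (y := y) h
    obtain ⟨χ, rfl⟩ := hg ψ (by ext x; exact hψ _ ⟨x, rfl⟩)
    exact hψy (by simp [hy])
  · rintro ⟨x, rfl⟩
    exact DFunLike.congr_fun hgf x

end DualSequence

/-! ### Functionals on projective tensor products -/

section Functionals

variable {X : Type*} [NormedAddCommGroup X] [NormedSpace ℂ X]
variable {Y : Type*} [NormedAddCommGroup Y] [NormedSpace ℂ Y]
variable {Z : Type*} [NormedAddCommGroup Z] [NormedSpace ℂ Z]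
variable {M : Type*} [NormedAddCommGroup M] [NormedSpace ℂ M]

namespace AlgTensor

/-- The linear functional on `X ⊗ M` that corresponds to a map `X → M'`. -/
def liftₗ (T : X →L[ℂ] StrongDual ℂ M) : AlgTensor X M →ₗ[ℂ] ℂ :=
  TensorProduct.lift
    ((ContinuousLinearMap.coeLM ℂ : StrongDual ℂ M →ₗ[ℂ] M →ₗ[ℂ] ℂ) ∘ₗ (T : X →ₗ[ℂ] StrongDual ℂ M))

theorem liftₗ_mk (T : X →L[ℂ] StrongDual ℂ M) (x : X) (m : M) : liftₗ T (mk x m) = T x m := rfl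

theorem norm_liftₗ_ofList_le (T : X →L[ℂ] StrongDual ℂ M) (l : List (X × M)) :
    ‖liftₗ T (ofList l)‖ ≤ ‖T‖ * cost l := by
  simp only [cost, ofList]
  induction l with
  | nil => simp
  | cons p l ih =>
    simp only [List.map_cons, List.sum_cons, map_add, mul_add, liftₗ_mk]
    refine norm_add_le_of_le ?_ ih
    rw [← mul_assoc]
    exact T.le_opNorm₂ _ _

theorem norm_liftₗ_le (T : X →L[ℂ] StrongDual ℂ M) (u : AlgTensor X M) :
    ‖liftₗ T u‖ ≤ ‖T‖ * ‖u‖ := by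
  rw [norm_def, projNorm, Real.mul_iInf_of_nonneg (norm_nonneg T)]
  obtain ⟨l, hl⟩ := exists_ofList u
  have : Nonempty {l : List (X × M) // ofList l = u} := ⟨⟨l, hl⟩⟩
  refine le_ciInf fun l => ?_
  obtain ⟨l, rfl⟩ := l
  exact norm_liftₗ_ofList_le T l

/-- The bounded functional on `X ⊗ M` that corresponds to a map `X → M'`. -/
def lift (T : X →L[ℂ] StrongDual ℂ M) : StrongDual ℂ (AlgTensor X M) :=
  (liftₗ T).mkContinuous ‖T‖ (norm_liftₗ_le T)

theorem norm_mk_le (x : X) (m : M) : ‖mk x m‖ ≤ ‖x‖ * ‖m‖ := by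
  simpa [ofList, cost, norm_def] using projNorm_le [(x, m)]

/-- `mk` as a bilinear map. -/
def mkₗ : X →ₗ[ℂ] M →ₗ[ℂ] AlgTensor X M := TensorProduct.mk ℂ X M

end AlgTensor

namespace ProjTensor

/-- The bounded functional on the projective tensor product that corresponds to a map `X → M'`. -/
def lift (T : X →L[ℂ] StrongDual ℂ M) : StrongDual ℂ (ProjTensor X M) :=
  (AlgTensor.lift T).fromCompletion

theorem lift_mk (T : X →L[ℂ] StrongDual ℂ M) (x : X) (m : M) : lift T (mk x m) = T x m :=
  ContinuousLinearMap.fromCompletion_apply_coe _ _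

variable (X M) in
/-- `mk` as a bounded bilinear map. -/
def mkL : X →L[ℂ] M →L[ℂ] ProjTensor X M :=
  LinearMap.mkContinuous₂
    (AlgTensor.mkₗ.compr₂ (UniformSpace.Completion.toComplL (𝕜 := ℂ)).toLinearMap) 1
    (fun x m => by
      rw [one_mul]
      exact (UniformSpace.Completion.norm_coe _).trans_le (AlgTensor.norm_mk_le x m))

theorem mkL_apply (x : X) (m : M) : mkL X M x m = mk x m := rfl

theorem ext_mk {E : Type*} [NormedAddCommGroup E] [NormedSpace ℂ E]
    {φ ψ : ProjTensor X M →L[ℂ] E} (h : ∀ x m, φ (mk x m) = ψ (mk x m)) : φ = ψ := by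
  ext t
  refine UniformSpace.Completion.induction_on t (isClosed_eq φ.continuous ψ.continuous) fun u => ?_
  have : φ.toLinearMap ∘ₗ (UniformSpace.Completion.toComplL (𝕜 := ℂ)).toLinearMap =
      ψ.toLinearMap ∘ₗ
        (UniformSpace.Completion.toComplL (𝕜 := ℂ) (E := AlgTensor X M)).toLinearMap :=
    TensorProduct.ext' (R := ℂ) (M := X) (N := M) h
  exact DFunLike.congr_fun this u

/-- The map `X → M'` that corresponds to a bounded functional. -/
def toDual (φ : StrongDual ℂ (ProjTensor X M)) : X →L[ℂ] StrongDual ℂ M :=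
  (ContinuousLinearMap.compL ℂ M (ProjTensor X M) ℂ φ).comp (mkL X M)

theorem toDual_apply (φ : StrongDual ℂ (ProjTensor X M)) (x : X) (m : M) :
    toDual φ x m = φ (mk x m) := rfl

theorem map_comp (g : Y →L[ℂ] Z) (f : X →L[ℂ] Y) :
    (map g).comp (map f) = map (M := M) (g.comp f) :=
  ext_mk fun x m => by simp [map_mk]

theorem map_id : map (M := M) (ContinuousLinearMap.id ℂ X) = ContinuousLinearMap.id ℂ _ :=
  ext_mk fun x m => by simp [map_mk]

end ProjTensor

/-! ### Functionals on balanced tensor products -/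

variable {A : Type*} [NormedRing A] [NormedAlgebra ℂ A]

/-- Closedness makes the balanced tensor product a normed space, so that Hahn–Banach duality applies
to it. -/
instance isClosed_balancedRelations (BX : BanachBimodule A X) (BM : BanachBimodule A M) :
    IsClosed (balancedRelations BX BM : Set (ProjTensor X M)) :=
  Submodule.isClosed_topologicalClosure _

namespace BimoduleTensor

variable {BX : BanachBimodule A X} {BY : BanachBimodule A Y} {BZ : BanachBimodule A Z}
  {BM : BanachBimodule A M}

/-- Each family of relations is killed by equivariance of `T` on one side, and the kernel of a
bounded functional is closed. With `isMap_toDual`, this matches functionals on the balanced tensor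
product with bimodule maps into the dual. -/
theorem balancedRelations_le_ker_lift {T : X →L[ℂ] StrongDual ℂ M} (hT : BX.IsMap BM.dual T) :
    balancedRelations BX BM ≤ (ProjTensor.lift T).ker := by
  refine Submodule.topologicalClosure_minimal _ ?_ (ProjTensor.lift T).isClosed_ker
  rw [Submodule.span_le]
  rintro _ (⟨a, x, m, rfl⟩ | ⟨a, x, m, rfl⟩)
  · simp [ProjTensor.lift_mk, hT.2, BanachBimodule.dual_ract_apply]
  · simp [ProjTensor.lift_mk, hT.1, BanachBimodule.dual_lact_apply]

/-- The bounded functional on `X ⊗ M` that corresponds to a bimodule map `X → M'`. -/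
def lift (T : X →L[ℂ] StrongDual ℂ M) (hT : BX.IsMap BM.dual T) :
    StrongDual ℂ (BimoduleTensor BX BM) :=
  (balancedRelations BX BM).liftQL (ProjTensor.lift T) (balancedRelations_le_ker_lift hT)

theorem lift_mk {T : X →L[ℂ] StrongDual ℂ M} (hT : BX.IsMap BM.dual T) (x : X) (m : M) :
    lift T hT ((balancedRelations BX BM).mkQ (ProjTensor.mk x m)) = T x m :=
  ProjTensor.lift_mk T x m

/-- The map `X → M'` that corresponds to a bounded functional on `X ⊗ M`. -/
def toDual (φ : StrongDual ℂ (BimoduleTensor BX BM)) : X →L[ℂ] StrongDual ℂ M :=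
  ProjTensor.toDual (φ.comp (balancedRelations BX BM).mkQL)

theorem toDual_apply (φ : StrongDual ℂ (BimoduleTensor BX BM)) (x : X) (m : M) :
    toDual φ x m = φ ((balancedRelations BX BM).mkQ (ProjTensor.mk x m)) := rfl

theorem isMap_toDual (φ : StrongDual ℂ (BimoduleTensor BX BM)) : BX.IsMap BM.dual (toDual φ) := by
  constructor
  · intro a x
    ext m
    rw [BanachBimodule.dual_lact_apply, toDual_apply, toDual_apply]
    congr 1
    exact (Submodule.Quotient.eq _).2 (Submodule.le_topologicalClosure _
      (Submodule.subset_span (Or.inr ⟨a, x, m, rfl⟩)))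
  · intro a x
    ext m
    rw [BanachBimodule.dual_ract_apply, toDual_apply, toDual_apply]
    congr 1
    exact (Submodule.Quotient.eq _).2 (Submodule.le_topologicalClosure _
      (Submodule.subset_span (Or.inl ⟨a, x, m, rfl⟩)))

theorem ext_mk {E : Type*} [NormedAddCommGroup E] [NormedSpace ℂ E]
    {φ ψ : BimoduleTensor BX BM →L[ℂ] E}
    (h : ∀ x m, φ ((balancedRelations BX BM).mkQ (ProjTensor.mk x m)) =
      ψ ((balancedRelations BX BM).mkQ (ProjTensor.mk x m))) : φ = ψ := by
  have := ProjTensor.ext_mk (φ := φ.comp (balancedRelations BX BM).mkQL)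
    (ψ := ψ.comp (balancedRelations BX BM).mkQL) h
  ext t
  obtain ⟨t, rfl⟩ := (balancedRelations BX BM).mkQ_surjective t
  exact DFunLike.congr_fun this t

variable (BM) in
/-- `BimoduleTensor.map` as a bounded map. -/
def mapL (f : X →L[ℂ] Y) (hf : BX.IsMap BY f) : BimoduleTensor BX BM →L[ℂ] BimoduleTensor BY BM :=
  ⟨map BM f hf, ((balancedRelations BX BM).liftQL
    ((balancedRelations BY BM).mkQL.comp (ProjTensor.map f)) (fun t ht => by
      simpa using balancedRelations_le_comap BM hf ht)).continuous⟩

theorem mapL_mk (f : X →L[ℂ] Y) (hf : BX.IsMap BY f) (x : X) (m : M) :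
    mapL BM f hf ((balancedRelations BX BM).mkQ (ProjTensor.mk x m)) =
      (balancedRelations BY BM).mkQ (ProjTensor.mk (f x) m) := by
  rw [← ProjTensor.map_mk]
  rfl

/-- The section `s` need not be a bimodule map, so it acts only on the unbalanced tensor product.
That suffices to produce preimages. -/
theorem map_surjective {g : Y →L[ℂ] Z} (hg : BY.IsMap BZ g) {s : Z →L[ℂ] Y}
    (hs : ∀ z, g (s z) = z) : Function.Surjective (map BM g hg) := by
  intro t
  obtain ⟨t, rfl⟩ := (balancedRelations BZ BM).mkQ_surjective t
  refine ⟨(balancedRelations BY BM).mkQ (ProjTensor.map s t), ?_⟩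
  change (balancedRelations BZ BM).mkQ (ProjTensor.map g (ProjTensor.map s t)) = _
  have : g.comp s = ContinuousLinearMap.id ℂ Z := by
    ext z
    exact hs z
  rw [← ContinuousLinearMap.comp_apply, ProjTensor.map_comp, this, ProjTensor.map_id]
  rfl

end BimoduleTensor

/-- A Banach bimodule is biflat if its dual is injective, in the sense that bounded bimodule maps
into it extend along admissible monomorphisms. -/
theorem BanachBimodule.isBiflat_of_extension {A : Type u} [NormedRing A] [NormedAlgebra ℂ A]
    {M : Type v} [NormedAddCommGroup M] [NormedSpace ℂ M] {BM : BanachBimodule A M}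
    (h : ∀ (X Y : Type w) [NormedAddCommGroup X] [NormedSpace ℂ X]
      [NormedAddCommGroup Y] [NormedSpace ℂ Y]
      (BX : BanachBimodule A X) (BY : BanachBimodule A Y) (f : X →L[ℂ] Y), BX.IsMap BY f →
      ∀ r : Y →L[ℂ] X, (∀ x, r (f x) = x) → ∀ T : X →L[ℂ] StrongDual ℂ M, BX.IsMap BM.dual T →
      ∃ T' : Y →L[ℂ] StrongDual ℂ M, BY.IsMap BM.dual T' ∧ ∀ x, T' (f x) = T x) :
    IsBiflat.{u, v, w} BM := by
  rintro X Y Z _ _ _ _ _ _ _ _ _ BX BY BZ f g hf hg ⟨-, hfg, -, ⟨r, hr⟩, s, hs⟩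
  rw [← and_assoc]
  refine ⟨?_, BimoduleTensor.map_surjective hg hs⟩
  refine ContinuousLinearMap.exact_of_dual_exact (f := BimoduleTensor.mapL BM f hf)
    (g := BimoduleTensor.mapL BM g hg) ?_ (fun φ => ?_) (fun ψ hψ => ?_)
  · refine BimoduleTensor.ext_mk fun x m => ?_
    rw [ContinuousLinearMap.comp_apply, BimoduleTensor.mapL_mk, BimoduleTensor.mapL_mk,
      hfg.apply_apply_eq_zero, ← ProjTensor.mkL_apply]
    simp
  · obtain ⟨T', hT', hTf⟩ := h X Y BX BY f hf r hr _ (BimoduleTensor.isMap_toDual φ)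
    refine ⟨BimoduleTensor.lift T' hT', BimoduleTensor.ext_mk fun x m => ?_⟩
    rw [ContinuousLinearMap.comp_apply, BimoduleTensor.mapL_mk, BimoduleTensor.lift_mk, hTf,
      BimoduleTensor.toDual_apply]
  · have hψf (x : X) : BimoduleTensor.toDual ψ (f x) = 0 := by
      ext m
      rw [BimoduleTensor.toDual_apply, ← BimoduleTensor.mapL_mk f hf]
      exact DFunLike.congr_fun hψ _
    -- The bimodule map attached to `ψ` kills the kernel of `g`, so it factors through `Z`. The
    -- factor is obtained by composing with `s`, and it is a bimodule map although `s` need not be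
    -- one.
    have hψs (y : Y) : BimoduleTensor.toDual ψ (s (g y)) = BimoduleTensor.toDual ψ y := by
      obtain ⟨x, hx⟩ := (hfg (s (g y) - y)).1 (by rw [map_sub, hs, sub_self])
      rw [← sub_eq_zero, ← map_sub, ← hx, hψf]
    have hg' : Function.Surjective g := fun z => ⟨s z, hs z⟩
    have hT := BimoduleTensor.isMap_toDual ψ
    have hTs : BZ.IsMap BM.dual ((BimoduleTensor.toDual ψ).comp s) := by
      constructor <;> intro a z <;> obtain ⟨y, rfl⟩ := hg' z
      · rw [← hg.1, ContinuousLinearMap.comp_apply, ContinuousLinearMap.comp_apply, hψs, hψs,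
          hT.1]
      · rw [← hg.2, ContinuousLinearMap.comp_apply, ContinuousLinearMap.comp_apply, hψs, hψs,
          hT.2]
    refine ⟨BimoduleTensor.lift _ hTs, BimoduleTensor.ext_mk fun y m => ?_⟩
    rw [ContinuousLinearMap.comp_apply, BimoduleTensor.mapL_mk, BimoduleTensor.lift_mk,
      ContinuousLinearMap.comp_apply, hψs, BimoduleTensor.toDual_apply]

end Functionals

end

/-- Here `Ell1 ℤ` is `ℓ¹(ℤ)` and `Ell1 ℕ` is `ℓ¹(ℤ₊)`. The universe `w` of the test bimodules in
the definition of biflatness is arbitrary. -/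
theorem proposition7p3 {N : Type v} [NormedAddCommGroup N] [NormedSpace ℂ N] [CompleteSpace N]
    (B : BanachBimodule (Ell1 ℤ) N) :
    BanachBimodule.IsBiflat.{0, v, w} (B.restrict Ell1.incl) ∧
      ∀ n : ℕ, 1 ≤ n →
        Subsingleton (Hochschild.Cohomology (B.restrict Ell1.incl).dual n) := by
  refine ⟨BanachBimodule.isBiflat_of_extension fun X Y _ _ _ _ BX BY f hf r hr T hT =>
    B.exists_extension hf hr hT, fun n hn => ?_⟩
  obtain ⟨n, rfl⟩ := Nat.exists_eq_add_of_le' hn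
  exact B.subsingleton_cohomology_dual n
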